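/- Let $I\subset(0,\infty)$ be a non-degenerate interval, let $p\in\mathbb R$, $p\neq 0$, and let $n\ge 1$ and $m\ge 1$ be integers. Write $f^k$ for the $k$-fold iterate of $f$, and let "open" and "closed" refer to the topology of $\mathbb R$. Consider, for continuous functions $f\colon I\to I$, the equation $$\frac{[f^{m}(x)]^p+[f^{2m}(x)]^p+\dots+[f^{nm}(x)]^p}{n}=x^p\qquad\text{for every }x\in I.\tag{$*$}$$ (i) If $m$ is odd, or if $I$ is neither open nor closed, then a function $f$ on $I$ is a continuous self-map of $I$ satisfying $(*)$ if and only if $f(x)=x$ for every $x\in I$. (ii) Suppose that $m$ is even and that $I$ is open or closed. For an interior point $a$ of $I$, call a function $f_0\colon I\cap(0,a]\to\mathbb R$ admissible if it is continuous and strictly decreasing, $f_0(a)=a$, and $\lim_{x\to\inf I}f_0(x)=\sup I$ (where $\sup I\in(0,\infty]$). Every admissible $f_0$ maps $I\cap(0,a]$ bijectively onto $I\cap[a,\infty)$. A function $f$ on $I$ is a continuous self-map of $I$ satisfying $(*)$ if and only if either $f(x)=x$ for every $x\in I$, or there are an interior point $a$ of $I$ and an admissible $f_0\colon I\cap(0,a]\to\mathbb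 R$ such that $$f(x)=\begin{cases}f_0(x)&\text{for } x\in I,\ x\le a,\\ f_0^{-1}(x)&\text{for } x\in I,\ x>a.\end{cases}$$ -/

import Mathlib

open Set Filter Topology

/-- `f` restricts to a continuous self-map of `I` with
`([f^m(x)]^p + [f^{2m}(x)]^p + ⋯ + [f^{nm}(x)]^p) / n = x^p` for every `x ∈ I`. -/
def IsIterateMeanSolution (I : Set ℝ) (p : ℝ) (n m : ℕ) (f : ℝ → ℝ) : Prop :=
  MapsTo f I I ∧ ContinuousOn f I ∧
    ∀ x ∈ I, (∑ j ∈ Finset.Icc 1 n, (f^[j * m] x) ^ p) / (n : ℝ) = x ^ p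

/-- `f₀` is continuous and strictly decreasing on `I ∩ (-∞, a]`, `f₀ a = a`, and
`f₀ x → sup I` as `x → inf I`. The supremum is taken in the extended reals, since `I` may be
unbounded above; `I` is meant to be an interval bounded below, so `sInf I` is its infimum. -/
structure IsDecreasingSeed (I : Set ℝ) (a : ℝ) (f₀ : ℝ → ℝ) : Prop where
  continuousOn : ContinuousOn f₀ (I ∩ Iic a)
  strictAntiOn : StrictAntiOn f₀ (I ∩ Iic a)
  map_self : f₀ a = a
  tendsto_sup : Tendsto (fun x => (f₀ x : EReal)) (𝓝[>] (sInf I))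
    (𝓝 (sSup ((fun x : ℝ => (x : EReal)) '' I)))

/-- The function equal to `f₀ x` for `x ≤ a` and to `f₀⁻¹ x` for `x > a`, where `f₀⁻¹` is the
inverse of the restriction of `f₀` to `I ∩ (-∞, a]`. -/
noncomputable def glueInverse (I : Set ℝ) (a : ℝ) (f₀ : ℝ → ℝ) (x : ℝ) : ℝ :=
  if x ≤ a then f₀ x else Function.invFunOn f₀ (I ∩ Iic a) x

/-! The equation recovers `x ^ p` from `f x`, so `f` is injective, hence strictly monotone. Put `G =
f^[m]` and `ψ x = x ^ p`: along each `G`-orbit every `ψ`-value is the mean of the next `n`. If `G`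
is increasing, orbits are monotone, so a non-fixed point would lie strictly on one side of that
mean; thus `G = id`. This gives `f = id` when `f` increases, and `f ∘ f = id` when `f` decreases and
`m` is even. If `f` decreases and `m` is odd, orbits of `G` alternate around a fixed point, which
`false_of_alternating_of_mean` excludes. A decreasing involution exchanges the two ends of `I`, so
`I` is open or closed, and it is determined by its restriction to the left of its fixed point, which
is the seed. -/

/-- A positive real sequence, each of whose terms is the mean of the next `n` terms, cannot
alternate strictly around a value `A` with monotone even and odd subsequences. -/
theorem false_of_alternating_of_mean {n : ℕ} (hn : 1 ≤ n) {u : ℕ → ℝ} {A : ℝ}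
    (hpos : ∀ k, 0 < u k)
    (hmean : ∀ k, ∑ j ∈ Finset.Icc 1 n, u (k + j) = n * u k)
    (heven : ∀ k, u (2 * k) < A) (hodd : ∀ k, A < u (2 * k + 1))
    (hmono : Monotone (fun k => u (2 * k)) ∨
      (Antitone (fun k => u (2 * k)) ∧ Monotone (fun k => u (2 * k + 1)))) : False := by
  have h1 : 1 ∈ Finset.Icc 1 n := Finset.mem_Icc.2 ⟨le_rfl, hn⟩
  have sum_lt {a : ℝ} {v : ℕ → ℝ} (hle : ∀ j, a ≤ v j) (hlt : a < v 1) :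
      n * a < ∑ j ∈ Finset.Icc 1 n, v j := by
    have : ∑ _j ∈ Finset.Icc 1 n, a < ∑ j ∈ Finset.Icc 1 n, v j :=
      Finset.sum_lt_sum (fun j _ => hle j) ⟨1, h1, hlt⟩
    simpa using this
  rcases hmono with hmono | ⟨hanti, hmono⟩
  · have hu1 : u 0 < u 1 := (heven 0).trans (hodd 0)
    have hle : ∀ j, u 0 ≤ u (0 + j) := by
      intro j
      rw [zero_add]
      rcases Nat.even_or_odd' j with ⟨k, rfl | rfl⟩
      · exact hmono (Nat.zero_le k)
      · exact ((heven 0).trans (hodd k)).le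
    exact (sum_lt hle hu1).ne' (hmean 0)
  -- Positivity enters here: an odd term is one summand of a positive sum equal to `n * u (2 * k)`.
  -- Both subsequences then converge, and the mean relation passes to the limits `L < M`.
  · have hbound : ∀ k, u (2 * k + 1) ≤ n * u 0 := by
      intro k
      have hs : u (2 * k + 1) ≤ ∑ j ∈ Finset.Icc 1 n, u (2 * k + j) :=
        Finset.single_le_sum (f := fun j => u (2 * k + j)) (fun j _ => (hpos _).le) h1
      rw [hmean] at hs
      exact hs.trans (mul_le_mul_of_nonneg_left (hanti (Nat.zero_le k)) n.cast_nonneg)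
    have hL := tendsto_atTop_ciInf hanti ⟨0, by rintro _ ⟨k, rfl⟩; exact (hpos _).le⟩
    have hM := tendsto_atTop_ciSup hmono ⟨n * u 0, by rintro _ ⟨k, rfl⟩; exact hbound k⟩
    set L := ⨅ k, u (2 * k)
    set M := ⨆ k, u (2 * k + 1)
    have hLA : L < A := (hanti.le_of_tendsto hL 0).trans_lt (heven 0)
    have hLM : L < M := hLA.trans ((hodd 0).trans_le (hmono.ge_of_tendsto hM 0))
    have hterm : ∀ j, Tendsto (fun k => u (2 * k + j)) atTop (𝓝 (if Even j then L else M)) := by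
      intro j
      rcases Nat.even_or_odd' j with ⟨i, rfl | rfl⟩
      · rw [if_pos (even_two_mul i)]
        refine (hL.comp (tendsto_add_atTop_nat i)).congr fun k => ?_
        simp only [Function.comp, mul_add]
      · have hne : ¬ Even (2 * i + 1) := by simp
        rw [if_neg hne]
        refine (hM.comp (tendsto_add_atTop_nat i)).congr fun k => ?_
        simp only [Function.comp]
        congr 1
        ring
    have hsum := tendsto_finsetSum (Finset.Icc 1 n) fun j _ => hterm j
    simp only [hmean] at hsum
    have heq := tendsto_nhds_unique (hL.const_mul (n : ℝ)) hsum
    refine (sum_lt (a := L) (v := fun j => if Even j then L else M) ?_ ?_).ne heq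
    · intro j
      split_ifs
      · exact le_rfl
      · exact hLM.le
    · simpa using hLM

/-! ### Orbits of monotone maps under the mean relation -/

section LinearOrder

variable {α : Type*} [LinearOrder α] {F G : α → α}

theorem StrictAnti.iterate_of_odd {m : ℕ} (hF : StrictAnti F) (hm : Odd m) :
    StrictAnti F^[m] := by
  obtain ⟨k, rfl⟩ := hm
  rw [Function.iterate_add, Function.iterate_mul, Function.iterate_one]
  exact (StrictMono.iterate (hF.comp hF) k).comp_strictAnti hF

theorem StrictMono.map_eq_self_of_iterate_eq_self (hF : StrictMono F) {k : ℕ} (hk : 1 ≤ k) {x : α}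
    (hx : F^[k] x = x) : F x = x := by
  rcases lt_trichotomy (F x) x with h | h | h
  · exact absurd hx (hF.strictAnti_iterate_of_map_lt h hk).ne
  · exact h
  · exact absurd hx (hF.strictMono_iterate_of_lt_map h hk).ne'

theorem StrictMono.eq_self_of_mean_iterate (hG : StrictMono G) {ψ : α → ℝ} (hψ : StrictMono ψ)
    {n : ℕ} (hn : 1 ≤ n) {x : α} (hmean : ∑ j ∈ Finset.Icc 1 n, ψ (G^[j] x) = n * ψ x) :
    G x = x := by
  have hne : (Finset.Icc 1 n).Nonempty := ⟨1, Finset.mem_Icc.2 ⟨le_rfl, hn⟩⟩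
  have hconst : ∑ _j ∈ Finset.Icc 1 n, ψ x = n * ψ x := by simp
  rcases lt_trichotomy (G x) x with h | h | h
  · refine absurd (hmean.trans hconst.symm) (Finset.sum_lt_sum_of_nonempty hne fun j hj => ?_).ne
    exact hψ (hG.strictAnti_iterate_of_map_lt h (Finset.mem_Icc.1 hj).1)
  · exact h
  · refine absurd (hmean.trans hconst.symm) (Finset.sum_lt_sum_of_nonempty hne fun j hj => ?_).ne'
    exact hψ (hG.strictMono_iterate_of_lt_map h (Finset.mem_Icc.1 hj).1)

theorem StrictAnti.false_of_mean_iterate (hG : StrictAnti G) {ψ : α → ℝ} (hψ : StrictMono ψ)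
    (hpos : ∀ x, 0 < ψ x) {n : ℕ} (hn : 1 ≤ n) {a x : α} (ha : G a = a) (hx : x ≠ a)
    (hmean : ∀ x, ∑ j ∈ Finset.Icc 1 n, ψ (G^[j] x) = n * ψ x) : False := by
  -- `G` swaps the two sides of `a`, so `x` may be replaced by `G x`.
  wlog hxa : x < a generalizing x with H
  · have hGx : G x < a := by simpa [ha] using hG (lt_of_le_of_ne (not_lt.1 hxa) hx.symm)
    exact H hGx.ne hGx
  have hG2 : StrictMono G^[2] := hG.comp hG
  have ha2 : G^[2] a = a := by simp [ha]
  have hiter (k : ℕ) : G^[2 * k] = (G^[2])^[k] := Function.iterate_mul G 2 k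
  have hiter' (k : ℕ) (y : α) : G^[2 * k + 1] y = (G^[2])^[k] (G y) := by
    rw [Function.iterate_succ_apply, hiter]
  have hfix (k : ℕ) : (G^[2])^[k] a = a := Function.iterate_fixed ha2 k
  have hGx : a < G x := by simpa [ha] using hG hxa
  refine false_of_alternating_of_mean hn (u := fun k => ψ (G^[k] x)) (A := ψ a)
    (fun k => hpos _) (fun k => ?_) (fun k => ?_) (fun k => ?_) ?_
  · simp only [Nat.add_comm k, Function.iterate_add_apply]
    exact hmean _
  · apply hψ
    rw [hiter]
    exact (hG2.iterate k hxa).trans_eq (hfix k)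
  · apply hψ
    rw [hiter']
    exact (hfix k).symm.trans_lt (hG2.iterate k hGx)
  · simp only [hiter, hiter']
    rcases le_total x (G^[2] x) with h | h
    · exact .inl (hψ.monotone.comp (hG2.monotone.monotone_iterate_of_le_map h))
    · refine .inr ⟨hψ.monotone.comp_antitone (hG2.monotone.antitone_iterate_of_map_le h), ?_⟩
      exact hψ.monotone.comp (hG2.monotone.monotone_iterate_of_le_map (hG.antitone h))

end LinearOrder

/-! ### Dichotomy: identity or decreasing involution -/

section Connected

variable {α : Type*} [LinearOrder α] [TopologicalSpace α] [OrderClosedTopology α]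
  [PreconnectedSpace α] {F : α → α}

theorem StrictAnti.exists_map_eq_self [Nonempty α] (hF : StrictAnti F) (hc : Continuous F) :
    ∃ a, F a = a := by
  obtain ⟨x⟩ := ‹Nonempty α›
  rcases le_total (F x) x with h | h
  · exact intermediate_value_univ₂ hc continuous_id h (hF.antitone h)
  · exact intermediate_value_univ₂ hc continuous_id (hF.antitone h) h

theorem eq_self_or_involutive_of_mean_iterate_of_strictMono [Nontrivial α] (hc : Continuous F)
    (hF : StrictMono F ∨ StrictAnti F) {ψ : α → ℝ} (hψ : StrictMono ψ) (hpos : ∀ x, 0 < ψ x)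
    {n m : ℕ} (hn : 1 ≤ n) (hm : 1 ≤ m)
    (hmean : ∀ x, ∑ j ∈ Finset.Icc 1 n, ψ (F^[j * m] x) = n * ψ x) :
    (∀ x, F x = x) ∨ (Even m ∧ StrictAnti F ∧ Function.Involutive F) := by
  have hmean' : ∀ x, ∑ j ∈ Finset.Icc 1 n, ψ ((F^[m])^[j] x) = n * ψ x := by
    simpa only [← Function.iterate_mul, mul_comm m] using hmean
  rcases hF with hF | hF
  · exact .inl fun x => hF.map_eq_self_of_iterate_eq_self hm
      ((hF.iterate m).eq_self_of_mean_iterate hψ hn (hmean' x))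
  · rcases Nat.even_or_odd m with hev | hodd
    · refine .inr ⟨hev, hF, fun x => ?_⟩
      obtain ⟨k, rfl⟩ := hev.two_dvd
      have hF2 : StrictMono F^[2] := hF.comp hF
      have hfix := (hF2.iterate k).eq_self_of_mean_iterate hψ hn
        (by simpa only [← Function.iterate_mul] using hmean' x)
      exact hF2.map_eq_self_of_iterate_eq_self (by lia) hfix
    · obtain ⟨a, ha⟩ := hF.exists_map_eq_self hc
      obtain ⟨x, hx⟩ := exists_ne a
      exact ((hF.iterate_of_odd hodd).false_of_mean_iterate hψ hpos hn
        (Function.iterate_fixed ha m) hx hmean').elim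

theorem eq_self_or_involutive_of_mean_iterate [Nontrivial α] (hc : Continuous F)
    (hF : StrictMono F ∨ StrictAnti F) {ψ : α → ℝ} (hψ : StrictMono ψ ∨ StrictAnti ψ)
    (hpos : ∀ x, 0 < ψ x) {n m : ℕ} (hn : 1 ≤ n) (hm : 1 ≤ m)
    (hmean : ∀ x, ∑ j ∈ Finset.Icc 1 n, ψ (F^[j * m] x) = n * ψ x) :
    (∀ x, F x = x) ∨ (Even m ∧ StrictAnti F ∧ Function.Involutive F) := by
  rcases hψ with hψ | hψ
  · exact eq_self_or_involutive_of_mean_iterate_of_strictMono hc hF hψ hpos hn hm hmean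
  -- A decreasing `ψ` (the case `p < 0`) becomes increasing on the order dual, while the
  -- monotonicity type of `F` is unchanged.
  · have : PreconnectedSpace αᵒᵈ := ‹PreconnectedSpace α›
    have h := eq_self_or_involutive_of_mean_iterate_of_strictMono (α := αᵒᵈ)
      (F := OrderDual.toDual ∘ F ∘ OrderDual.ofDual) (ψ := ψ ∘ OrderDual.ofDual) hc
      (hF.imp StrictMono.dual StrictAnti.dual) hψ.dual_left hpos hn hm hmean
    exact h.imp id fun ⟨h1, h2, h3⟩ => ⟨h1, fun a b hab => h2 hab, h3⟩

end Connected

/-! ### Solutions and decreasing involutions on a real interval -/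

section Interval

variable {I : Set ℝ} {f : ℝ → ℝ}

theorem ContinuousOn.strictMonoOn_or_strictAntiOn_of_injOn (hI : I.OrdConnected)
    (hne : I.Nonempty) (hc : ContinuousOn f I) (hinj : InjOn f I) :
    StrictMonoOn f I ∨ StrictAntiOn f I := by
  have : Inhabited I := ⟨⟨hne.some, hne.some_mem⟩⟩
  have h : StrictMono (I.domRestrict f) ∨ StrictAnti (I.domRestrict f) :=
    Continuous.strictMono_of_inj hc.domRestrict hinj.injective
  exact h.imp strictMono_domRestrict.mp strictAntiOn_iff_strictAnti.mpr

theorem strictMono_or_strictAnti_rpow (hpos : I ⊆ Ioi 0) {p : ℝ} (hp : p ≠ 0) :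
    StrictMono (fun x : I => (x : ℝ) ^ p) ∨ StrictAnti (fun x : I => (x : ℝ) ^ p) := by
  rcases lt_or_gt_of_ne hp with h | h
  · exact .inr fun x y hxy => Real.rpow_lt_rpow_of_neg (hpos x.2) hxy h
  · exact .inl fun x y hxy => Real.rpow_lt_rpow (le_of_lt (hpos x.2)) hxy h

theorem IsIterateMeanSolution.sum_eq {p : ℝ} {n m : ℕ} (hn : 1 ≤ n)
    (hf : IsIterateMeanSolution I p n m f) {x : ℝ} (hx : x ∈ I) :
    ∑ j ∈ Finset.Icc 1 n, (f^[j * m] x) ^ p = n * x ^ p := by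
  have hn0 : (n : ℝ) ≠ 0 := by positivity
  rw [← hf.2.2 x hx, mul_div_cancel₀ _ hn0]

theorem IsIterateMeanSolution.injOn (hpos : I ⊆ Ioi 0) {p : ℝ} (hp : p ≠ 0) {n m : ℕ}
    (hm : 1 ≤ m) (hf : IsIterateMeanSolution I p n m f) : InjOn f I := by
  intro x hx y hy hxy
  have hpow : x ^ p = y ^ p := by
    rw [← hf.2.2 x hx, ← hf.2.2 y hy]
    congr 1
    refine Finset.sum_congr rfl fun j hj => ?_
    have hj : 1 ≤ j * m := Nat.mul_pos (Finset.mem_Icc.1 hj).1 hm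
    obtain ⟨k, hk⟩ := Nat.exists_eq_add_of_le' hj
    rw [hk, Function.iterate_succ_apply, Function.iterate_succ_apply, hxy]
  exact (Real.rpow_left_inj (le_of_lt (hpos hx)) (le_of_lt (hpos hy)) hp).1 hpow

theorem IsIterateMeanSolution.eq_self_or_involutive (hI : I.OrdConnected) (hnt : I.Nontrivial)
    (hpos : I ⊆ Ioi 0) {p : ℝ} (hp : p ≠ 0) {n m : ℕ} (hn : 1 ≤ n) (hm : 1 ≤ m)
    (hf : IsIterateMeanSolution I p n m f) :
    (∀ x ∈ I, f x = x) ∨ (Even m ∧ StrictAntiOn f I ∧ ∀ x ∈ I, f (f x) = x) := by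
  have hmaps := hf.1
  have : Nontrivial I := hnt.coe_sort
  have : PreconnectedSpace I := Subtype.preconnectedSpace hI.isPreconnected
  have hmono := ContinuousOn.strictMonoOn_or_strictAntiOn_of_injOn hI hnt.nonempty hf.2.1
    (hf.injOn hpos hp hm)
  have h := eq_self_or_involutive_of_mean_iterate (F := hmaps.restrict f I I)
    (hf.2.1.mapsToRestrict hmaps)
    (hmono.imp (fun h x y hxy => h x.2 y.2 hxy) (fun h x y hxy => h x.2 y.2 hxy))
    (strictMono_or_strictAnti_rpow hpos hp) (fun x => Real.rpow_pos_of_pos (hpos x.2) p) hn hm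
    (fun x => by
      simp only [MapsTo.iterate_restrict, MapsTo.val_restrict_apply]
      exact hf.sum_eq hn x.2)
  refine h.imp (fun h x hx => congrArg Subtype.val (h ⟨x, hx⟩)) fun ⟨h1, h2, h3⟩ => ⟨h1, ?_, ?_⟩
  · exact fun x hx y hy hxy => h2 (a := ⟨x, hx⟩) (b := ⟨y, hy⟩) hxy
  · exact fun x hx => congrArg Subtype.val (h3 ⟨x, hx⟩)

theorem isIterateMeanSolution_of_iterate_eq_self {p : ℝ} {n m : ℕ} (hn : 1 ≤ n)
    (hmaps : MapsTo f I I) (hc : ContinuousOn f I) (hiter : ∀ x ∈ I, f^[m] x = x) :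
    IsIterateMeanSolution I p n m f := by
  refine ⟨hmaps, hc, fun x hx => ?_⟩
  have hterm : ∀ j, f^[j * m] x = x := fun j => by
    rw [mul_comm, Function.iterate_mul]
    exact Function.iterate_fixed (hiter x hx) j
  have hn0 : (n : ℝ) ≠ 0 := by positivity
  simp [hterm, hn0]

theorem isIterateMeanSolution_of_eq_self {p : ℝ} {n m : ℕ} (hn : 1 ≤ n)
    (hf : ∀ x ∈ I, f x = x) : IsIterateMeanSolution I p n m f :=
  isIterateMeanSolution_of_iterate_eq_self hn (fun x hx => (hf x hx).symm ▸ hx)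
    (continuousOn_id.congr hf) fun x hx => Function.iterate_fixed (hf x hx) m

/-- Such a map is an order isomorphism from `I` to its dual, and order isomorphisms are continuous
for order topologies. Continuity of the glued function thus needs no matching at `a`. -/
theorem StrictAntiOn.continuousOn_of_involutive (hI : I.OrdConnected) (hmaps : MapsTo f I I)
    (hanti : StrictAntiOn f I) (hinv : ∀ x ∈ I, f (f x) = x) : ContinuousOn f I := by
  let F : I → I := hmaps.restrict f I I
  have hF : Function.Involutive F := fun x => Subtype.ext (hinv x x.2)
  let e : I ≃o Iᵒᵈ :=
    { toEquiv := hF.toPerm.trans OrderDual.toDual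
      map_rel_iff' := fun {x y} => hanti.le_iff_ge y.2 x.2 }
  have he : Continuous F := continuous_ofDual.comp e.continuous
  exact continuousOn_iff_continuous_domRestrict.2 (continuous_subtype_val.comp he)

/-- A least element `c` is sent to a greatest one, so `I = Icc c (f c)`; without a least element
there is no greatest one either. -/
theorem isOpen_or_isClosed_of_involutive (hI : I.OrdConnected) (hmaps : MapsTo f I I)
    (hanti : StrictAntiOn f I) (hinv : ∀ x ∈ I, f (f x) = x) : IsOpen I ∨ IsClosed I := by
  have hge : ∀ {x y}, x ∈ I → y ∈ I → (x ≤ f y ↔ y ≤ f x) := fun {x y} hx hy => by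
    conv_lhs => rw [← hinv x hx]
    exact hanti.le_iff_ge (hmaps hx) hy
  by_cases hmin : ∃ c ∈ I, ∀ x ∈ I, c ≤ x
  · obtain ⟨c, hc, hcx⟩ := hmin
    have : I = Icc c (f c) := Subset.antisymm
      (fun x hx => ⟨hcx x hx, (hge hx hc).2 (hcx _ (hmaps hx))⟩) (hI.out hc (hmaps hc))
    exact .inr (this ▸ isClosed_Icc)
  · push Not at hmin
    refine .inl (isOpen_iff_mem_nhds.2 fun x hx => ?_)
    obtain ⟨y, hy, hyx⟩ := hmin x hx
    obtain ⟨z, hz, hzx⟩ := hmin (f x) (hmaps hx)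
    have hxz : x < f z := by
      have := hanti hz (hmaps hx) hzx
      rwa [hinv x hx] at this
    exact mem_of_superset (Icc_mem_nhds hyx hxz) (hI.out hy (hmaps hz))

end Interval

/-! ### Seeds and the gluing construction -/

section Seed

variable {I : Set ℝ} {a : ℝ} {f f₀ : ℝ → ℝ}

theorem Set.OrdConnected.Ioo_sInf_subset (hI : I.OrdConnected) {b : ℝ} (hb : b ∈ I) :
    Ioo (sInf I) b ⊆ I := by
  intro x hx
  obtain ⟨y, hy, hyx⟩ := exists_lt_of_csInf_lt ⟨b, hb⟩ hx.1
  exact hI.out hy hb ⟨hyx.le, hx.2.le⟩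

theorem sInf_lt_of_mem_interior (hbdd : BddBelow I) (ha : a ∈ interior I) : sInf I < a := by
  obtain ⟨b, hba, hb⟩ := mem_nhdsLE_iff_exists_Icc_subset.1
    (mem_nhdsWithin_of_mem_nhds (mem_interior_iff_mem_nhds.1 ha))
  exact (csInf_le hbdd (hb ⟨le_rfl, le_of_lt hba⟩)).trans_lt hba

theorem IsDecreasingSeed.exists_lt_of_sInf_lt (hI : I.OrdConnected)
    (hs : IsDecreasingSeed I a f₀) {x : ℝ} (hx : x ∈ I ∩ Iic a) (hlt : sInf I < x) :
    ∃ z ∈ I, f₀ x < z := by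
  obtain ⟨x', hx'⟩ := exists_between hlt
  have hx'I : x' ∈ I ∩ Iic a := ⟨hI.Ioo_sInf_subset hx.1 hx', hx'.2.le.trans hx.2⟩
  have hle : (f₀ x' : EReal) ≤ sSup ((fun x : ℝ => (x : EReal)) '' I) := by
    refine ge_of_tendsto hs.tendsto_sup ?_
    filter_upwards [Ioo_mem_nhdsGT hx'.1] with y hy
    exact EReal.coe_le_coe_iff.2 (hs.strictAntiOn.antitoneOn
      ⟨hI.Ioo_sInf_subset hx'I.1 hy, hy.2.le.trans hx'I.2⟩ hx'I hy.2.le)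
  have hlt' : (f₀ x : EReal) < sSup ((fun x : ℝ => (x : EReal)) '' I) :=
    (EReal.coe_lt_coe_iff.2 (hs.strictAntiOn hx'I hx hx'.2)).trans_le hle
  obtain ⟨_, ⟨z, hz, rfl⟩, hxz⟩ := lt_sSup_iff.1 hlt'
  exact ⟨z, hz, EReal.coe_lt_coe_iff.1 hxz⟩

theorem IsDecreasingSeed.exists_lt_map (hI : I.OrdConnected) (haI : a ∈ I) (ha : sInf I < a)
    (hs : IsDecreasingSeed I a f₀) {y z : ℝ} (hz : z ∈ I) (hyz : y < z) :
    ∃ x ∈ I ∩ Iic a, y < f₀ x := by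
  have hlt : (y : EReal) < sSup ((fun x : ℝ => (x : EReal)) '' I) :=
    lt_sSup_iff.2 ⟨z, mem_image_of_mem _ hz, EReal.coe_lt_coe_iff.2 hyz⟩
  have hmem : ∀ᶠ x in 𝓝[>] (sInf I), x ∈ Ioo (sInf I) a := Ioo_mem_nhdsGT ha
  obtain ⟨x, hx, hyx⟩ :=
    (hmem.and (hs.tendsto_sup.eventually_const_lt hlt)).exists
  exact ⟨x, ⟨hI.Ioo_sInf_subset haI hx, hx.2.le⟩, EReal.coe_lt_coe_iff.1 hyx⟩

/-- Continuity at the left endpoint makes the extended-real limit finite. Hence no seed exists on a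
closed half-line `[c, ∞)`. -/
theorem IsDecreasingSeed.isLUB_map_sInf (hI : I.OrdConnected) (haI : a ∈ I) (ha : sInf I < a)
    (hs : IsDecreasingSeed I a f₀) (hmem : sInf I ∈ I) : IsLUB I (f₀ (sInf I)) := by
  have hsub : Ioo (sInf I) a ⊆ I ∩ Iic a := fun x hx => ⟨hI.Ioo_sInf_subset haI hx, hx.2.le⟩
  have hcont : Tendsto f₀ (𝓝[>] (sInf I)) (𝓝 (f₀ (sInf I))) := by
    rw [← nhdsWithin_Ioo_eq_nhdsGT ha]
    exact (hs.continuousOn (sInf I) ⟨hmem, ha.le⟩).mono hsub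
  have heq : (f₀ (sInf I) : EReal) = sSup ((fun x : ℝ => (x : EReal)) '' I) :=
    tendsto_nhds_unique ((continuous_coe_real_ereal.tendsto _).comp hcont) hs.tendsto_sup
  constructor
  · intro x hx
    exact EReal.coe_le_coe_iff.1 (heq ▸ le_sSup (mem_image_of_mem _ hx))
  · intro b hb
    refine EReal.coe_le_coe_iff.1 (heq ▸ sSup_le ?_)
    rintro _ ⟨x, hx, rfl⟩
    exact EReal.coe_le_coe_iff.2 (hb hx)

theorem IsDecreasingSeed.bijOn (hI : I.OrdConnected) (hbdd : BddBelow I)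
    (hoc : IsOpen I ∨ IsClosed I) (ha : a ∈ interior I) (hs : IsDecreasingSeed I a f₀) :
    BijOn f₀ (I ∩ Iic a) (I ∩ Ici a) := by
  have haI : a ∈ I := interior_subset ha
  have hlt : sInf I < a := sInf_lt_of_mem_interior hbdd ha
  have hge : ∀ x ∈ I ∩ Iic a, a ≤ f₀ x := fun x hx =>
    hs.map_self.symm.trans_le (hs.strictAntiOn.antitoneOn hx ⟨haI, mem_Iic.2 le_rfl⟩ hx.2)
  obtain ⟨hup, hlow⟩ : (∀ x ∈ I ∩ Iic a, ∃ z ∈ I, f₀ x ≤ z) ∧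
      ∀ y ∈ I, ∃ x ∈ I ∩ Iic a, y ≤ f₀ x := by
    -- Open: the supremum is approached but never reached. Closed: it is attained at `sInf I`.
    rcases hoc with ho | hc
    · refine ⟨fun x hx => ?_, fun y hy => ?_⟩
      · obtain ⟨z, hz, hxz⟩ := hs.exists_lt_of_sInf_lt hI hx
          (sInf_lt_of_mem_interior hbdd (ho.interior_eq.symm ▸ hx.1))
        exact ⟨z, hz, hxz.le⟩
      · obtain ⟨z, hyz, hz⟩ := mem_nhdsGE_iff_exists_Icc_subset.1
          (mem_nhdsWithin_of_mem_nhds (ho.mem_nhds hy))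
        obtain ⟨x, hx, hyx⟩ := hs.exists_lt_map hI haI hlt (hz ⟨le_of_lt hyz, le_rfl⟩) hyz
        exact ⟨x, hx, hyx.le⟩
    · have hmem : sInf I ∈ I := hc.csInf_mem ⟨a, haI⟩ hbdd
      have hlub := hs.isLUB_map_sInf hI haI hlt hmem
      have hcI : sInf I ∈ I ∩ Iic a := ⟨hmem, hlt.le⟩
      exact ⟨fun x hx => ⟨_, hlub.mem_of_isClosed ⟨a, haI⟩ hc,
        hs.strictAntiOn.antitoneOn hcI hx (csInf_le hbdd hx.1)⟩, fun y hy => ⟨_, hcI, hlub.1 hy⟩⟩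
  refine ⟨fun x hx => ?_, hs.strictAntiOn.injOn, fun y hy => ?_⟩
  · obtain ⟨z, hz, hxz⟩ := hup x hx
    exact ⟨hI.out haI hz ⟨hge x hx, hxz⟩, hge x hx⟩
  · obtain ⟨x, hx, hyx⟩ := hlow y hy.1
    have hsub : Icc x a ⊆ I ∩ Iic a := fun t ht => ⟨hI.out hx.1 haI ht, ht.2⟩
    obtain ⟨t, ht, rfl⟩ := intermediate_value_Icc' hx.2 (hs.continuousOn.mono hsub)
      ⟨hs.map_self.trans_le hy.2, hyx⟩
    exact mem_image_of_mem _ (hsub ht)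

theorem glueInverse_of_le {x : ℝ} (hx : x ≤ a) : glueInverse I a f₀ x = f₀ x := if_pos hx

theorem glueInverse_of_lt {x : ℝ} (hx : a < x) :
    glueInverse I a f₀ x = Function.invFunOn f₀ (I ∩ Iic a) x := if_neg hx.not_ge

theorem IsDecreasingSeed.glueInverse_properties (haI : a ∈ I) (hs : IsDecreasingSeed I a f₀)
    (hb : BijOn f₀ (I ∩ Iic a) (I ∩ Ici a)) :
    MapsTo (glueInverse I a f₀) I I ∧ StrictAntiOn (glueInverse I a f₀) I ∧
      ∀ x ∈ I, glueInverse I a f₀ (glueInverse I a f₀ x) = x := by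
  have hle : ∀ x ∈ I, x ≤ a → glueInverse I a f₀ x ∈ I ∩ Ici a := fun x hx hxa => by
    rw [glueInverse_of_le hxa]
    exact hb.mapsTo ⟨hx, hxa⟩
  have hgt : ∀ x ∈ I, a < x → glueInverse I a f₀ x ∈ I ∩ Iio a ∧
      f₀ (glueInverse I a f₀ x) = x := fun x hx hax => by
    rw [glueInverse_of_lt hax]
    have himg : x ∈ f₀ '' (I ∩ Iic a) := hb.surjOn ⟨hx, hax.le⟩
    have hmem := Function.invFunOn_mem himg
    have heq := Function.invFunOn_eq himg
    refine ⟨⟨hmem.1, mem_Iio.2 (lt_of_le_of_ne hmem.2 fun h => ?_)⟩, heq⟩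
    rw [h, hs.map_self] at heq
    exact hax.ne heq
  refine ⟨fun x hx => ?_, fun x hx y hy hxy => ?_, fun x hx => ?_⟩
  · rcases le_or_gt x a with h | h
    · exact (hle x hx h).1
    · exact (hgt x hx h).1.1
  · rcases le_or_gt y a with hya | hya
    · rw [glueInverse_of_le hya, glueInverse_of_le (hxy.le.trans hya)]
      exact hs.strictAntiOn ⟨hx, hxy.le.trans hya⟩ ⟨hy, hya⟩ hxy
    obtain ⟨hy1, hy2⟩ := hgt y hy hya
    rcases le_or_gt x a with hxa | hxa
    · exact lt_of_lt_of_le hy1.2 (hle x hx hxa).2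
    · obtain ⟨hx1, hx2⟩ := hgt x hx hxa
      rw [← hx2, ← hy2] at hxy
      exact (hs.strictAntiOn.lt_iff_gt ⟨hx1.1, mem_Iic.2 (le_of_lt hx1.2)⟩
        ⟨hy1.1, mem_Iic.2 (le_of_lt hy1.2)⟩).1 hxy
  · rcases lt_trichotomy x a with h | rfl | h
    · have hlt : a < f₀ x := by
        simpa only [hs.map_self] using
          hs.strictAntiOn ⟨hx, h.le⟩ ⟨haI, mem_Iic.2 le_rfl⟩ h
      rw [glueInverse_of_le h.le, glueInverse_of_lt hlt]
      exact hb.injOn.leftInvOn_invFunOn ⟨hx, h.le⟩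
    · rw [glueInverse_of_le le_rfl, hs.map_self, glueInverse_of_le le_rfl, hs.map_self]
    · obtain ⟨h1, h2⟩ := hgt x hx h
      rw [glueInverse_of_le h1.2.le, h2]

theorem isIterateMeanSolution_of_eq_glueInverse (hI : I.OrdConnected) {p : ℝ} {n m : ℕ}
    (hn : 1 ≤ n) (hm : Even m) (haI : a ∈ I) (hs : IsDecreasingSeed I a f₀)
    (hb : BijOn f₀ (I ∩ Iic a) (I ∩ Ici a)) (hf : ∀ x ∈ I, f x = glueInverse I a f₀ x) :
    IsIterateMeanSolution I p n m f := by
  obtain ⟨hmaps, hanti, hinv⟩ := hs.glueInverse_properties haI hb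
  have heq : EqOn (glueInverse I a f₀) f I := fun x hx => (hf x hx).symm
  have hinv' : ∀ x ∈ I, f (f x) = x := fun x hx => by
    rw [hf x hx, hf _ (hmaps hx), hinv x hx]
  have hmaps' : MapsTo f I I := hmaps.congr heq
  refine isIterateMeanSolution_of_iterate_eq_self hn hmaps'
    ((hanti.congr heq).continuousOn_of_involutive hI hmaps' hinv') fun x hx => ?_
  obtain ⟨k, rfl⟩ := hm.two_dvd
  rw [Function.iterate_mul]
  exact Function.iterate_fixed (hinv' x hx) k

theorem exists_fixedPoint_mem_interior_of_strictAntiOn (hI : I.OrdConnected) (hnt : I.Nontrivial)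
    (hmaps : MapsTo f I I) (hc : ContinuousOn f I) (hanti : StrictAntiOn f I) :
    ∃ a ∈ interior I, f a = a := by
  have : Nontrivial I := hnt.coe_sort
  have : PreconnectedSpace I := Subtype.preconnectedSpace hI.isPreconnected
  have hF : StrictAnti (hmaps.restrict f I I) := fun x y hxy => hanti x.2 y.2 hxy
  obtain ⟨⟨a, haI⟩, ha⟩ := hF.exists_map_eq_self (hc.mapsToRestrict hmaps)
  replace ha : f a = a := congrArg Subtype.val ha
  -- Any other point and its image lie on opposite sides of `a`.
  refine ⟨a, mem_interior_iff_mem_nhds.2 ?_, ha⟩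
  obtain ⟨x, hx, hxa⟩ := hnt.exists_ne a
  rcases lt_or_gt_of_ne hxa with h | h
  · have h' : a < f x := by simpa only [ha] using hanti hx haI h
    exact mem_of_superset (Icc_mem_nhds h h') (hI.out hx (hmaps hx))
  · have h' : f x < a := by simpa only [ha] using hanti haI hx h
    exact mem_of_superset (Icc_mem_nhds h' h) (hI.out (hmaps hx) hx)

theorem StrictAntiOn.isDecreasingSeed_of_involutive (hI : I.OrdConnected) (hbdd : BddBelow I)
    (hmaps : MapsTo f I I) (hc : ContinuousOn f I) (hanti : StrictAntiOn f I)
    (hinv : ∀ x ∈ I, f (f x) = x) (ha : a ∈ interior I) (hfa : f a = a) :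
    IsDecreasingSeed I a f := by
  have haI : a ∈ I := interior_subset ha
  refine ⟨hc.mono inter_subset_left, hanti.mono inter_subset_left, hfa, ?_⟩
  have hmem : ∀ᶠ x in 𝓝[>] (sInf I), x ∈ I :=
    mem_of_superset (Ioo_mem_nhdsGT (sInf_lt_of_mem_interior hbdd ha)) (hI.Ioo_sInf_subset haI)
  refine tendsto_order.2 ⟨fun y hy => ?_, fun y hy => ?_⟩
  · obtain ⟨w, haw, hw⟩ := mem_nhdsGE_iff_exists_Icc_subset.1
      (mem_nhdsWithin_of_mem_nhds (mem_interior_iff_mem_nhds.1 ha))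
    have hwI : w ∈ I := hw ⟨le_of_lt haw, le_rfl⟩
    have haS : (a : EReal) < sSup ((fun x : ℝ => (x : EReal)) '' I) :=
      lt_sSup_iff.2 ⟨w, mem_image_of_mem _ hwI, EReal.coe_lt_coe_iff.2 haw⟩
    -- The maximum with `a` places the real `t` between `a` and `z`, hence in `I`; then `x < f t`
    -- gives `t < f x`.
    obtain ⟨_, ⟨z, hz, rfl⟩, hyz⟩ := lt_sSup_iff.1 (max_lt hy haS)
    obtain ⟨t, ht1, ht2⟩ := EReal.lt_iff_exists_real_btwn.1 hyz
    have htz : t < z := EReal.coe_lt_coe_iff.1 ht2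
    have hat : a < t := EReal.coe_lt_coe_iff.1 ((le_max_right _ _).trans_lt ht1)
    have htI : t ∈ I := hI.out haI hz ⟨hat.le, htz.le⟩
    have hlt : sInf I < f t := (csInf_le hbdd (hmaps hz)).trans_lt (hanti htI hz htz)
    filter_upwards [hmem, Ioo_mem_nhdsGT hlt] with x hx hxt
    have htx := hanti hx (hmaps htI) hxt.2
    rw [hinv t htI] at htx
    exact (le_max_left _ _).trans_lt (ht1.trans (EReal.coe_lt_coe_iff.2 htx))
  · filter_upwards [hmem] with x hx
    exact (le_sSup (mem_image_of_mem _ (hmaps hx))).trans_lt hy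

theorem StrictAntiOn.eq_glueInverse_of_involutive (hmaps : MapsTo f I I)
    (hanti : StrictAntiOn f I) (hinv : ∀ x ∈ I, f (f x) = x) (haI : a ∈ I) (hfa : f a = a)
    {x : ℝ} (hx : x ∈ I) : f x = glueInverse I a f x := by
  rcases le_or_gt x a with h | h
  · rw [glueInverse_of_le h]
  · have hlt : f x < a := by simpa only [hfa] using hanti haI hx h
    have hinj : InjOn f (I ∩ Iic a) := hanti.injOn.mono inter_subset_left
    have := hinj.leftInvOn_invFunOn ⟨hmaps hx, hlt.le⟩
    rw [hinv x hx] at this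
    rw [glueInverse_of_lt h, this]

end Seed

theorem mainTheorem7 (I : Set ℝ) (hI : I.OrdConnected) (hnt : I.Nontrivial)
    (hpos : I ⊆ Set.Ioi 0) (p : ℝ) (hp : p ≠ 0) (n m : ℕ) (hn : 1 ≤ n) (hm : 1 ≤ m) :
    ((Odd m ∨ (¬ IsOpen I ∧ ¬ IsClosed I)) →
      ∀ f : ℝ → ℝ, IsIterateMeanSolution I p n m f ↔ ∀ x ∈ I, f x = x) ∧
    ((Even m ∧ (IsOpen I ∨ IsClosed I)) →
      (∀ a ∈ interior I, ∀ f₀ : ℝ → ℝ, IsDecreasingSeed I a f₀ →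
        Set.BijOn f₀ (I ∩ Set.Iic a) (I ∩ Set.Ici a)) ∧
      ∀ f : ℝ → ℝ, IsIterateMeanSolution I p n m f ↔
        (∀ x ∈ I, f x = x) ∨
        ∃ a ∈ interior I, ∃ f₀ : ℝ → ℝ, IsDecreasingSeed I a f₀ ∧
          ∀ x ∈ I, f x = glueInverse I a f₀ x) := by
  have hbdd : BddBelow I := ⟨0, fun x hx => le_of_lt (hpos hx)⟩
  refine ⟨fun h f => ⟨fun hf => ?_, isIterateMeanSolution_of_eq_self hn⟩, fun ⟨hev, hoc⟩ => ?_⟩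
  · refine (hf.eq_self_or_involutive hI hnt hpos hp hn hm).resolve_right ?_
    rintro ⟨hev, hanti, hinv⟩
    rcases h with hodd | ⟨ho, hc⟩
    · exact Nat.not_even_iff_odd.2 hodd hev
    · exact (isOpen_or_isClosed_of_involutive hI hf.1 hanti hinv).elim ho hc
  · have hbij : ∀ a ∈ interior I, ∀ f₀ : ℝ → ℝ, IsDecreasingSeed I a f₀ →
        BijOn f₀ (I ∩ Iic a) (I ∩ Ici a) := fun a ha f₀ hs => hs.bijOn hI hbdd hoc ha
    refine ⟨hbij, fun f => ⟨fun hf => ?_, ?_⟩⟩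
    · refine (hf.eq_self_or_involutive hI hnt hpos hp hn hm).imp_right ?_
      rintro ⟨-, hanti, hinv⟩
      obtain ⟨a, ha, hfa⟩ :=
        exists_fixedPoint_mem_interior_of_strictAntiOn hI hnt hf.1 hf.2.1 hanti
      exact ⟨a, ha, f, hanti.isDecreasingSeed_of_involutive hI hbdd hf.1 hf.2.1 hinv ha hfa,
        fun x hx => hanti.eq_glueInverse_of_involutive hf.1 hinv (interior_subset ha) hfa hx⟩
    · rintro (hf | ⟨a, ha, f₀, hs, hf⟩)
      · exact isIterateMeanSolution_of_eq_self hn hf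
      · exact isIterateMeanSolution_of_eq_glueInverse hI hn hev (interior_subset ha) hs
          (hbij a ha f₀ hs) hf
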